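/- Let $t\ge 0$, $n=3t+1$, and let $\mathbb V$ be a set of possible input and decision values with more than $n$ elements. **Model.** $n$ parties communicate over asynchronous point-to-point links. The local state of a party is its input $v_i\in\mathbb V$ and the sequence of its local events (actions performed, messages received). A randomized algorithm $\mathcal A$ prescribes the next action of each party as a function of its local state: an internal step, a decision on a value of $\mathbb V$, sending a message, or accessing a probabilistic object. The objects are specified by $\mathcal A$: an access returns a value drawn from a discrete law that depends on the state of the object, the accessing party and the query, and may change that state. At each point in time the adversary chooses either a party that takes a step or a pending message that is delivered. A strategy of a *weak and static* adversary fixes from the start (knowing the inputs) a set of $f\le t$ corrupted parties. Its choices, including the arbitrary actions of the corrupted parties, depend only on what it has observed so far: which parties have output a decision, which messages are pending on which links (not their contents), and the local states of the corrupted parties. An *ensemble* of $\mathcal A$ consists of inputs $(v_i)$ and such a strategy that is fair with probability one (every honest party moves infinitely often, every message sent is eventually delivered). It induces a tree of executions and a probability measure on its infinite paths. Let $\mathcal V_{in}$ be the multiset of all inputs, and $\mathrm{max\_mult}(\mathcal V_{in})$ the largest multiplicity of a value in it. Fix a class $\mathcal S$ of strategies of weak and static adversaries (for example all of them, or the computationally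 bounded ones) that contains at least the elementary ones: each corrupted party stays silent or runs $\mathcal A$ with an input chosen by the adversary, and the scheduling (steps, and deliveries of the oldest pending message of a link) is read off a finite table from the time modulo the length of the table and the set of parties that have decided. All requirements below concern ensembles with strategies in $\mathcal S$. - *Agreement*: in every path of every ensemble all honest parties that decide output the same value. - *Probabilistic Termination*: in every ensemble every honest party decides with probability $1$. - *Qualitative Validity*: in every ensemble with $f$ corrupted parties and inputs $\mathcal V_{in}$, if $\mathrm{max\_mult}(\mathcal V_{in})-f\ge 2t+1$, then in every path all honest parties that decide output values in $\mathcal V_{in}$; otherwise the probability that the honest parties decide on a value in $\mathcal V_{in}$ is at least $1-\frac{f}{n-t}$. A property $\Phi$ of algorithms is *strictly stronger* than Qualitative Validity if every algorithm that satisfies $\Phi$ satisfies Qualitative Validity and, in addition, there are $\hat f\le t$ and a multiset $\mathcal V_{in}$ of $n$ values with $\mathrm{max\_mult}(\mathcal V_{in})-\hat f<2t+1$ such that in every ensemble with $\hat f$ corrupted parties and inputs $\mathcal V_{in}$ the probability that the honest parties decide on a value in $\mathcal V_{in}$ is strictly larger than $1-\frac{\hat f}{n-t}$. **Theorem.** If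 $\Phi$ is strictly stronger than Qualitative Validity, then no algorithm satisfies Agreement, Probabilistic Termination and $\Phi$. -/

import Mathlib

open MeasureTheory ProbabilityTheory

namespace ByzAgr

universe u w

/-- The `n = 3t + 1` parties. -/
abbrev Party (t : ℕ) : Type := Fin (3 * t + 1)

/-- An action that a party can take in one local step: an internal step, outputting a decision,
sending a message on a link, or accessing a probabilistic object with some query. -/
inductive Action (t : ℕ) (V : Type u) (Msg Obj Query : Type w) : Type (max u w)
  | skip : Action t V Msg Obj Query
  | decide (x : V) : Action t V Msg Obj Query
  | send (dst : Party t) (m : Msg) : Action t V Msg Obj Query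
  | access (o : Obj) (q : Query) : Action t V Msg Obj Query

/-- A local event at a party: an action it performed (an access is recorded together with the value
returned by the object), or the receipt of a message. -/
inductive LocalEvent (t : ℕ) (V : Type u) (Msg Obj Query Ret : Type w) : Type (max u w)
  | skip : LocalEvent t V Msg Obj Query Ret
  | decide (x : V) : LocalEvent t V Msg Obj Query Ret
  | send (dst : Party t) (m : Msg) : LocalEvent t V Msg Obj Query Ret
  | access (o : Obj) (q : Query) (r : Ret) : LocalEvent t V Msg Obj Query Ret
  | recv (src : Party t) (m : Msg) : LocalEvent t V Msg Obj Query Ret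

/-- A randomized message-passing algorithm for `3t + 1` parties with inputs and decisions in `V`.
`prog` gives the next action of a party as a function of its local state (its input and the
sequence of its local events, oldest first). The specification of the probabilistic objects is part
of the algorithm: an access returns a random value (with a discrete law) depending on the state of
the object, the accessing party and the query, and then changes the state of that object. -/
structure Algorithm (t : ℕ) (V : Type u) where
  Msg : Type w
  Obj : Type w
  Query : Type w
  Ret : Type w
  ObjState : Type w
  prog : Party t → V → List (LocalEvent t V Msg Obj Query Ret) → Action t V Msg Obj Query
  objInit : Obj → ObjState
  objRet : Obj → ObjState → Party t → Query → PMF Ret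
  objNext : Obj → ObjState → Party t → Query → Ret → ObjState

variable {t : ℕ} {V : Type u}

/-- The actions of the parties that run `A`. -/
abbrev Algorithm.Act (A : Algorithm.{u, w} t V) : Type (max u w) :=
  Action t V A.Msg A.Obj A.Query

/-- The local events of the parties that run `A`. -/
abbrev Algorithm.Event (A : Algorithm.{u, w} t V) : Type (max u w) :=
  LocalEvent t V A.Msg A.Obj A.Query A.Ret

/-- A local state: the input and the finite sequence of local events so far, oldest first. -/
structure LocalState (A : Algorithm.{u, w} t V) where
  input : V
  events : List A.Event

/-- The value `x` has been output as a decision in this local state. -/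
def LocalState.Decided {A : Algorithm.{u, w} t V} (s : LocalState A) (x : V) : Prop :=
  LocalEvent.decide x ∈ s.events

/-- A configuration. The `m`-th message sent on the link from `i` to `j` is `(sent i j)[m]`;
it is pending as long as `m ∉ delivered i j`. -/
structure Config (A : Algorithm.{u, w} t V) where
  loc : Party t → LocalState A
  sent : Party t → Party t → List A.Msg
  delivered : Party t → Party t → Finset ℕ
  obj : A.Obj → A.ObjState

/-- The initial configuration with the given inputs. -/
def Config.init (A : Algorithm.{u, w} t V) (inputs : Party t → V) : Config A where
  loc i := ⟨inputs i, []⟩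
  sent _ _ := []
  delivered _ _ := ∅
  obj := A.objInit

/-- The indices of the pending messages on the link from `i` to `j`. -/
def Config.pending {A : Algorithm.{u, w} t V} (c : Config A) (i j : Party t) : Finset ℕ :=
  Finset.range (c.sent i j).length \ c.delivered i j

/-- Append a local event to the local state of party `i`. -/
def Config.log {A : Algorithm.{u, w} t V} (c : Config A) (i : Party t) (e : A.Event) : Config A :=
  { c with loc := Function.update c.loc i ⟨(c.loc i).input, (c.loc i).events ++ [e]⟩ }

/-- Delivery to `j` of the `m`-th message sent by `i` to `j`. If no such message is pending, then
nothing happens. -/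
def Config.deliver {A : Algorithm.{u, w} t V} (c : Config A) (i j : Party t) (m : ℕ) : Config A :=
  match (c.sent i j)[m]? with
  | none => c
  | some x =>
    if m ∈ c.delivered i j then c
    else
      { c.log j (LocalEvent.recv i x) with
        delivered := fun i' j' =>
          if i' = i ∧ j' = j then insert m (c.delivered i j) else c.delivered i' j' }

open Classical in
/-- Party `i` performs the action `a`: the law of the next configuration. Only an access to a
probabilistic object is random. -/
noncomputable def Config.perform {A : Algorithm.{u, w} t V} (c : Config A) (i : Party t) :
    A.Act → PMF (Config A)
  | Action.skip => PMF.pure (c.log i LocalEvent.skip)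
  | Action.decide x => PMF.pure (c.log i (LocalEvent.decide x))
  | Action.send j m => PMF.pure
      { c.log i (LocalEvent.send j m) with
        sent := fun i' j' => if i' = i ∧ j' = j then c.sent i j ++ [m] else c.sent i' j' }
  | Action.access o q => (A.objRet o (c.obj o) i q).map fun r =>
      { c.log i (LocalEvent.access o q r) with
        obj := Function.update c.obj o (A.objNext o (c.obj o) i q r) }

/-- A scheduling decision: the party that takes the next local step, or the message (the `m`-th one
on the link from `i` to `j`) that is delivered. -/
inductive Sched (t : ℕ) : Type
  | step (i : Party t) : Sched t
  | deliver (i j : Party t) (m : ℕ) : Sched t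

/-- What a weak adversary sees of a configuration: which parties have output a decision, which
messages are pending on the links (but not their contents), and the local states of the corrupted
parties. The local states of the honest parties, the contents of messages in transit
and the states of the probabilistic objects are not visible. -/
structure Observation (A : Algorithm.{u, w} t V) where
  hasDecided : Set (Party t)
  pending : Party t → Party t → Finset ℕ
  corruptedState : Party t → Option (LocalState A)

/-- The observation of a configuration by an adversary that has corrupted the given parties. -/
def Config.observe {A : Algorithm.{u, w} t V} (corrupted : Finset (Party t)) (c : Config A) :
    Observation A where
  hasDecided := {i | ∃ x, (c.loc i).Decided x}
  pending := c.pending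
  corruptedState i := if i ∈ corrupted then some (c.loc i) else none

/-- A strategy of a weak and static adversary: a set of at most `t` corrupted parties, fixed from
the start, and, as functions of the past observations (newest first) and the present one,
the next scheduling decision and the action of each corrupted party, should it be scheduled. -/
structure Strategy (A : Algorithm.{u, w} t V) where
  corrupted : Finset (Party t)
  card_corrupted_le : corrupted.card ≤ t
  sched : List (Observation A) → Observation A → Sched t
  byz : List (Observation A) → Observation A → Party t → A.Act

/-- A node of the tree of executions: a configuration together with the observations that the
adversary made at its ancestors (newest first). -/
structure Node (A : Algorithm.{u, w} t V) where
  past : List (Observation A)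
  conf : Config A

instance (A : Algorithm.{u, w} t V) : MeasurableSpace (Node A) := ⊤

variable {A : Algorithm.{u, w} t V}

/-- The scheduling decision of the strategy at a node. -/
def Strategy.choice (σ : Strategy A) (v : Node A) : Sched t :=
  σ.sched v.past (v.conf.observe σ.corrupted)

/-- The law of the configuration that follows a node: honest parties act as the algorithm
prescribes, corrupted ones as the strategy does. -/
noncomputable def Strategy.nextConf (σ : Strategy A) (v : Node A) : PMF (Config A) :=
  match σ.choice v with
  | Sched.step i =>
    v.conf.perform i
      (if i ∈ σ.corrupted then σ.byz v.past (v.conf.observe σ.corrupted) i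
        else A.prog i (v.conf.loc i).input (v.conf.loc i).events)
  | Sched.deliver i j m => PMF.pure (v.conf.deliver i j m)

/-- The weights of the edges from a node to its children. -/
noncomputable def Strategy.next (σ : Strategy A) (v : Node A) : PMF (Node A) :=
  (σ.nextConf v).map fun c => ⟨v.conf.observe σ.corrupted :: v.past, c⟩

/-- The transition kernel of the tree. -/
noncomputable def Strategy.kernel (σ : Strategy A) : Kernel (Node A) (Node A) where
  toFun v := (σ.next v).toMeasure
  measurable' := measurable_from_top

instance (σ : Strategy A) : IsMarkovKernel σ.kernel :=
  ⟨fun v => (inferInstance : IsProbabilityMeasure (σ.next v).toMeasure)⟩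

/-- The root of the tree. -/
def root (A : Algorithm.{u, w} t V) (inputs : Party t → V) : Node A :=
  ⟨[], Config.init A inputs⟩

/-- The transition kernel from the history up to time `k`, which depends on the node at time `k`
only. -/
noncomputable def Strategy.histKernel (σ : Strategy A) (k : ℕ) :
    Kernel (∀ _ : Finset.Iic k, Node A) (Node A) :=
  σ.kernel.comap (fun h => h ⟨k, Finset.mem_Iic.2 le_rfl⟩) (measurable_pi_apply _)

instance (σ : Strategy A) (k : ℕ) : IsMarkovKernel (σ.histKernel k) :=
  inferInstanceAs (IsMarkovKernel (σ.kernel.comap _ _))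

/-- The probability measure on infinite sequences of nodes, under which the sequences through
a given node have as probability the product of the weights on the way from the root to it. -/
noncomputable def Strategy.pathMeasure (σ : Strategy A) (inputs : Party t → V) :
    Measure (ℕ → Node A) :=
  Kernel.traj (X := fun _ => Node A) σ.histKernel 0 (fun _ => root A inputs)

instance (σ : Strategy A) (inputs : Party t → V) : IsProbabilityMeasure (σ.pathMeasure inputs) :=
  inferInstanceAs (IsProbabilityMeasure (Kernel.traj (X := fun _ => Node A) σ.histKernel 0 _))

/-- Fairness of an infinite path: every honest party is scheduled infinitely often, and every
message sent is eventually delivered. -/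
def Strategy.Fair (σ : Strategy A) (ω : ℕ → Node A) : Prop :=
  (∀ i, i ∉ σ.corrupted → ∀ k, ∃ k' ≥ k, σ.choice (ω k') = Sched.step i) ∧
  (∀ i j k m, m ∈ (ω k).conf.pending i j → ∃ k', m ∈ (ω k').conf.delivered i j)

/-- An ensemble of the algorithm `A`: the tree of executions determined by the inputs and by a
strategy of a weak and static adversary that is fair with probability one. -/
structure Ensemble (A : Algorithm.{u, w} t V) where
  inputs : Party t → V
  strategy : Strategy A
  fair : ∀ᵐ ω ∂(strategy.pathMeasure inputs), strategy.Fair ω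

namespace Ensemble

/-- The probability measure on the paths of the ensemble. -/
noncomputable abbrev prob (E : Ensemble A) : Measure (ℕ → Node A) :=
  E.strategy.pathMeasure E.inputs

/-- The paths of the ensemble: all edges have positive weight. -/
def IsPath (E : Ensemble A) (ω : ℕ → Node A) : Prop :=
  ω 0 = root A E.inputs ∧ ∀ k, ω (k + 1) ∈ (E.strategy.next (ω k)).support

/-- The multiset of all inputs. -/
def inputMultiset (E : Ensemble A) : Multiset V := Finset.univ.val.map E.inputs

/-- The number of corrupted parties. -/
def numCorrupted (E : Ensemble A) : ℕ := E.strategy.corrupted.card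

/-- Party `i` is honest. -/
def Honest (E : Ensemble A) (i : Party t) : Prop := i ∉ E.strategy.corrupted

/-- Party `i` decides `x` in the execution `ω`. -/
def Decides (ω : ℕ → Node A) (i : Party t) (x : V) : Prop :=
  ∃ k, ((ω k).conf.loc i).Decided x

/-- In every path, an honest party that decides, decides on an input value. -/
def AlwaysDecidesInput (E : Ensemble A) : Prop :=
  ∀ ω, E.IsPath ω → ∀ i, E.Honest i → ∀ x, Decides ω i x → x ∈ E.inputMultiset

/-- The probability that the honest parties decide on an input value. -/
noncomputable def probDecidesInput (E : Ensemble A) : ℝ :=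
  E.prob.real {ω | ∀ i, E.Honest i → ∃ x ∈ E.inputMultiset, Decides ω i x}

end Ensemble

open Classical in
/-- The maximal multiplicity of an element of a multiset. -/
noncomputable def maxMult (M : Multiset V) : ℕ := M.toFinset.sup fun x => M.count x

/-- A type of weak and static adversaries: the strategies that are available against an
algorithm. -/
abbrev AdversaryClass (t : ℕ) (V : Type u) : Type (max u (w + 1)) :=
  ∀ A : Algorithm.{u, w} t V, Set (Strategy A)

/-- Agreement: in every path of every ensemble, all honest parties that decide output the same
value. -/
def Agreement (Adv : AdversaryClass.{u, w} t V) (A : Algorithm.{u, w} t V) : Prop :=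
  ∀ E : Ensemble A, E.strategy ∈ Adv A → ∀ ω, E.IsPath ω →
    ∀ i j, E.Honest i → E.Honest j →
      ∀ x y, Ensemble.Decides ω i x → Ensemble.Decides ω j y → x = y

/-- Probabilistic Termination: in every ensemble every honest party decides with probability 1. -/
def ProbTermination (Adv : AdversaryClass.{u, w} t V) (A : Algorithm.{u, w} t V) : Prop :=
  ∀ E : Ensemble A, E.strategy ∈ Adv A →
    ∀ i, E.Honest i → ∀ᵐ ω ∂E.prob, ∃ x, Ensemble.Decides ω i x

/-- Qualitative Validity. -/
def QualitativeValidity (Adv : AdversaryClass.{u, w} t V) (A : Algorithm.{u, w} t V) : Prop :=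
  ∀ E : Ensemble A, E.strategy ∈ Adv A →
    ((2 * t + 1 : ℤ) ≤ (maxMult E.inputMultiset : ℤ) - E.numCorrupted →
      E.AlwaysDecidesInput) ∧
    ((maxMult E.inputMultiset : ℤ) - E.numCorrupted < (2 * t + 1 : ℤ) →
      1 - (E.numCorrupted : ℝ) / ((3 * t + 1 : ℝ) - t) ≤ E.probDecidesInput)

/-- For some number `f ≤ t` of corrupted parties and some multiset `M` of `3t + 1` inputs outside
the first case of Qualitative Validity, the bound of Qualitative Validity is strictly exceeded
in every ensemble with this number of corrupted parties and these inputs. -/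
def StrictSomewhere (Adv : AdversaryClass.{u, w} t V) (A : Algorithm.{u, w} t V) : Prop :=
  ∃ f : ℕ, f ≤ t ∧ ∃ M : Multiset V, M.card = 3 * t + 1 ∧
    (maxMult M : ℤ) - f < (2 * t + 1 : ℤ) ∧
    ∀ E : Ensemble A, E.strategy ∈ Adv A → E.numCorrupted = f → E.inputMultiset = M →
      1 - (f : ℝ) / ((3 * t + 1 : ℝ) - t) < E.probDecidesInput

/-- The validity property `Φ` of algorithms is strictly stronger than Qualitative Validity. -/
def StrictlyStronger (Adv : AdversaryClass.{u, w} t V) (Φ : Algorithm.{u, w} t V → Prop) : Prop :=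
  ∀ A, Φ A → QualitativeValidity Adv A ∧ StrictSomewhere Adv A

/-- An entry of a scheduling table: let a party take a step, or deliver the oldest pending message
of a link (if there is one). -/
inductive Entry (t : ℕ) : Type
  | step (i : Party t) : Entry t
  | deliverOldest (i j : Party t) : Entry t

/-- An elementary strategy, which needs no computing power beyond that of the parties. Each
corrupted party either stays silent (`pretend i = none`) or runs the algorithm as if its input were
`x` (`pretend i = some x`). The scheduling is read off a finite table, from the time modulo the
length of the table and the set of parties that have output a decision. -/
noncomputable def elementaryStrategy (A : Algorithm.{u, w} t V) (corrupted : Finset (Party t))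
    (hc : corrupted.card ≤ t) (pretend : Party t → Option V) (len : ℕ)
    (table : Fin (len + 1) → Set (Party t) → Entry t) : Strategy A where
  corrupted := corrupted
  card_corrupted_le := hc
  sched past now :=
    match table (Fin.ofNat (len + 1) past.length) now.hasDecided with
    | Entry.step i => Sched.step i
    | Entry.deliverOldest i j => Sched.deliver i j (sInf (now.pending i j : Set ℕ))
  byz _ now i :=
    match pretend i, now.corruptedState i with
    | some x, some s => A.prog i x s.events
    | _, _ => Action.skip

/-- The adversary is at least able to use the elementary strategies. This is so if it may use all
strategies, and also if it is computationally bounded but able to run the algorithm itself. -/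
def CanRunAlgorithm (Adv : AdversaryClass.{u, w} t V) : Prop :=
  ∀ (A : Algorithm.{u, w} t V) (corrupted : Finset (Party t)) (hc : corrupted.card ≤ t)
    (pretend : Party t → Option V) (len : ℕ) (table : Fin (len + 1) → Set (Party t) → Entry t),
    elementaryStrategy A corrupted hc pretend len table ∈ Adv A

end ByzAgr

/-!
Delay a set `D` of `t` parties until all others have decided: by termination the others do decide,
and what `D` holds cannot matter. Among the other parties choose `f` parties `C` such that no value
occurs more than `t` times among the remaining `2t + 1 - f`, and consider the run without corruption
in which `C` and `D` hold a fresh value `z`.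

For every `a ≠ z`, this run looks the same if the at most `t` holders of `a` have the input `z` and
are corrupted, but act as if they held `a`. Then `a` is not an input, so by validity `a` is decided
with probability at most (number of holders of `a`) / (2t + 1). Summing over `a`, the value `z` is
decided with probability at least `f / (2t + 1)`. The run also looks the same if `C` and `D` have
the given inputs and `C` is corrupted and acts as if it held `z`. Now `z` is not an input, so the
probability of deciding on an input is at most `1 - f / (2t + 1)`.
-/

namespace ByzAgr

universe u w

section MarkovChain

variable {α β : Type*} {κ : α → PMF α} {B S : Set α} {a : α}

/-- The law after `n` steps of the Markov chain with transition probabilities `κ` that starts in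
`a`. -/
noncomputable def chainLaw (κ : α → PMF α) : ℕ → α → PMF α
  | 0, a => PMF.pure a
  | n + 1, a => (κ a).bind (chainLaw κ n)

theorem chainLaw_succ_eq_bind (κ : α → PMF α) (n : ℕ) (a : α) :
    chainLaw κ (n + 1) a = (chainLaw κ n a).bind κ := by
  induction n generalizing a with
  | zero =>
    rw [chainLaw, chainLaw, PMF.pure_bind]
    exact PMF.bind_pure _
  | succ n ih =>
    calc (κ a).bind (chainLaw κ (n + 1))
        = (κ a).bind fun b => (chainLaw κ n b).bind κ := congrArg _ (funext ih)
      _ = ((κ a).bind (chainLaw κ n)).bind κ := (PMF.bind_bind _ _ _).symm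

/-- A set that the Markov chain with transition probabilities `κ` never leaves. -/
def Absorbing (κ : α → PMF α) (B : Set α) : Prop :=
  ∀ a ∈ B, (κ a).support ⊆ B

theorem Absorbing.support_chainLaw_subset (hB : Absorbing κ B) (ha : a ∈ B) (n : ℕ) :
    (chainLaw κ n a).support ⊆ B := by
  induction n generalizing a with
  | zero => simpa [chainLaw] using ha
  | succ n ih =>
    rw [chainLaw, PMF.support_bind]
    exact Set.iUnion₂_subset fun b hb => ih (hB a ha hb)

open Classical in
/-- The transition probabilities of the chain that is stopped as soon as it is in `S`. -/
noncomputable def stopOn (S : Set α) (κ : α → PMF α) (a : α) : PMF α :=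
  if a ∈ S then PMF.pure a else κ a

theorem stopOn_of_mem (ha : a ∈ S) : stopOn S κ a = PMF.pure a := if_pos ha

theorem stopOn_of_notMem (ha : a ∉ S) : stopOn S κ a = κ a := if_neg ha

theorem Absorbing.stopOn (hB : Absorbing κ B) (S : Set α) : Absorbing (stopOn S κ) B := by
  intro a ha
  by_cases haS : a ∈ S
  · simpa [stopOn_of_mem haS] using ha
  · simpa [stopOn_of_notMem haS] using hB a ha

theorem chainLaw_stopOn_of_mem (ha : a ∈ S) (n : ℕ) :
    chainLaw (stopOn S κ) n a = PMF.pure a := by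
  induction n with
  | zero => rfl
  | succ n ih => rw [chainLaw, stopOn_of_mem ha, PMF.pure_bind, ih]

theorem Absorbing.chainLaw_stopOn_le (hB : Absorbing κ B) (S : Set α) (n : ℕ) (a : α) :
    (chainLaw (ByzAgr.stopOn S κ) n a).toOuterMeasure B ≤
      (chainLaw κ n a).toOuterMeasure B := by
  classical
  induction n generalizing a with
  | zero => rfl
  | succ n ih =>
    by_cases haS : a ∈ S
    · rw [chainLaw_stopOn_of_mem haS, PMF.toOuterMeasure_pure_apply]
      split_ifs with haB
      · exact ((PMF.toOuterMeasure_apply_eq_one_iff _ _).2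
          (hB.support_chainLaw_subset haB _)).ge
      · exact zero_le
    · rw [chainLaw, chainLaw, stopOn_of_notMem haS, PMF.toOuterMeasure_bind_apply,
        PMF.toOuterMeasure_bind_apply]
      exact ENNReal.tsum_le_tsum fun b => mul_le_mul_right (ih b) _

theorem toOuterMeasure_apply_le_one (p : PMF α) (B : Set α) : p.toOuterMeasure B ≤ 1 :=
  (measure_mono (Set.subset_univ B)).trans
    ((p.toOuterMeasure_apply_eq_one_iff _).2 (Set.subset_univ _)).le

theorem chainLaw_le_chainLaw_stopOn (κ : α → PMF α) (S : Set α) (n : ℕ) (a : α) :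
    (chainLaw κ n a).toOuterMeasure S ≤ (chainLaw (stopOn S κ) n a).toOuterMeasure S := by
  induction n generalizing a with
  | zero => rfl
  | succ n ih =>
    by_cases haS : a ∈ S
    · rw [chainLaw_stopOn_of_mem haS,
        (PMF.toOuterMeasure_apply_eq_one_iff (PMF.pure a) S).2 (by simpa using haS)]
      exact toOuterMeasure_apply_le_one _ _
    · rw [chainLaw, chainLaw, stopOn_of_notMem haS, PMF.toOuterMeasure_bind_apply,
        PMF.toOuterMeasure_bind_apply]
      exact ENNReal.tsum_le_tsum fun b => mul_le_mul_right (ih b) _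

theorem Absorbing.map_chainLaw (hB : Absorbing κ B) {κ' : β → PMF β} {f : α → β}
    (hf : ∀ a ∈ B, (κ a).map f = κ' (f a)) (n : ℕ) (ha : a ∈ B) :
    (chainLaw κ n a).map f = chainLaw κ' n (f a) := by
  induction n with
  | zero => exact PMF.pure_map f a
  | succ n ih =>
    rw [chainLaw_succ_eq_bind, chainLaw_succ_eq_bind, ← ih, PMF.bind_map, PMF.map_bind]
    ext y
    simp only [PMF.bind_apply, Function.comp_apply]
    refine tsum_congr fun b => ?_
    by_cases hb : b ∈ (chainLaw κ n a).support
    · rw [hf b (hB.support_chainLaw_subset ha n hb)]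
    · rw [(PMF.apply_eq_zero_iff _ _).2 hb, zero_mul, zero_mul]

theorem lintegral_toMeasure [MeasurableSpace α] [MeasurableSingletonClass α] (p : PMF α)
    (f : α → ENNReal) : ∫⁻ a, f a ∂p.toMeasure = ∑' a, p a * f a := by
  calc ∫⁻ a, f a ∂p.toMeasure
      = ∫⁻ a in p.support, f a ∂p.toMeasure := by rw [p.restrict_toMeasure_support]
    _ = ∑' a : p.support, f a * p.toMeasure {(a : α)} := lintegral_countable _ p.support_countable
    _ = ∑' a : p.support, p a * f a := by
      refine tsum_congr fun a => ?_
      rw [p.toMeasure_apply_singleton _ (measurableSet_singleton _), mul_comm]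
    _ = ∑' a, p a * f a :=
      tsum_subtype_eq_of_support_subset (f := fun a => p a * f a)
        (Function.support_mul_subset_left _ _)

end MarkovChain

variable {t : ℕ} {V : Type u} {A : Algorithm.{u, w} t V}

section PathMeasure

instance : DiscreteMeasurableSpace (Node A) := ⟨fun _ => trivial⟩

variable (σ : Strategy A) (inputs : Party t → V)

theorem Strategy.map_eval_pair_pathMeasure (n : ℕ) :
    (σ.pathMeasure inputs).map (fun ω => (ω n, ω (n + 1))) =
      (σ.pathMeasure inputs).map (fun ω => ω n) ⊗ₘ σ.kernel := by
  let last (h : Finset.Iic n → Node A) : Node A := h ⟨n, Finset.mem_Iic.2 le_rfl⟩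
  have hlast : Measurable last := measurable_pi_apply _
  set μ := Kernel.partialTraj (X := fun _ => Node A) σ.histKernel 0 n fun _ => root A inputs
  have hhist : (σ.pathMeasure inputs).map (Preorder.frestrictLe n) = μ :=
    Kernel.traj_map_frestrictLe_apply (κ := σ.histKernel) (X := fun _ => Node A) 0 n _
  have hjoint : μ ⊗ₘ σ.histKernel n =
      (σ.pathMeasure inputs).map fun ω => (Preorder.frestrictLe n ω, ω (n + 1)) :=
    Kernel.partialTraj_compProd_eq_map_traj (X := fun _ => Node A) (Nat.zero_le n)
  have hmarkov : (μ ⊗ₘ σ.histKernel n).map (Prod.map last id) = μ.map last ⊗ₘ σ.kernel := by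
    refine Measure.ext fun s hs => ?_
    rw [Measure.map_apply (hlast.prodMap measurable_id) hs,
      Measure.compProd_apply (hlast.prodMap measurable_id hs), Measure.compProd_apply hs,
      lintegral_map .of_discrete hlast]
    rfl
  calc (σ.pathMeasure inputs).map (fun ω => (ω n, ω (n + 1)))
      = (μ ⊗ₘ σ.histKernel n).map (Prod.map last id) := by
        rw [hjoint, Measure.map_map (hlast.prodMap measurable_id) (by fun_prop)]
        rfl
    _ = μ.map last ⊗ₘ σ.kernel := hmarkov
    _ = (σ.pathMeasure inputs).map (fun ω => ω n) ⊗ₘ σ.kernel := by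
        rw [← hhist, Measure.map_map hlast (by fun_prop)]
        rfl

theorem Strategy.map_eval_pathMeasure (n : ℕ) :
    (σ.pathMeasure inputs).map (fun ω => ω n) =
      (chainLaw σ.next n (root A inputs)).toMeasure := by
  induction n with
  | zero =>
    let first (h : Finset.Iic 0 → Node A) : Node A := h ⟨0, Finset.mem_Iic.2 le_rfl⟩
    have hfirst : Measurable first := measurable_pi_apply _
    have hroot : (σ.pathMeasure inputs).map (Preorder.frestrictLe 0) =
        Measure.dirac fun _ => root A inputs := by
      rw [Strategy.pathMeasure, Kernel.traj_map_frestrictLe_apply, Kernel.partialTraj_self,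
        Kernel.id_apply]
    calc (σ.pathMeasure inputs).map (fun ω => ω 0)
        = ((σ.pathMeasure inputs).map (Preorder.frestrictLe 0)).map first := by
          rw [Measure.map_map hfirst (by fun_prop)]
          rfl
      _ = (PMF.pure (root A inputs)).toMeasure := by
          rw [hroot, Measure.map_dirac' hfirst, PMF.toMeasure_pure]
  | succ n ih =>
    have hsnd := congrArg Measure.snd (σ.map_eval_pair_pathMeasure inputs n)
    rw [Measure.snd_map_prodMk (by fun_prop), Measure.snd_compProd, ih] at hsnd
    rw [hsnd, chainLaw_succ_eq_bind]
    refine Measure.ext fun B hB => ?_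
    rw [Measure.bind_apply hB σ.kernel.aemeasurable, lintegral_toMeasure,
      PMF.toMeasure_bind_apply _ _ _ hB]
    rfl

theorem Strategy.pathMeasure_eval_mem (n : ℕ) (B : Set (Node A)) :
    σ.pathMeasure inputs {ω | ω n ∈ B} =
      (chainLaw σ.next n (root A inputs)).toOuterMeasure B := by
  rw [← PMF.toMeasure_apply_eq_toOuterMeasure_apply _ (.of_discrete (s := B)),
    ← σ.map_eval_pathMeasure, Measure.map_apply (measurable_pi_apply n) .of_discrete]
  rfl

/-- The sequence `ω` starts in the root and only uses edges of positive weight: `Ensemble.IsPath`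
for strategies that need not be fair. -/
def Strategy.IsPath (ω : ℕ → Node A) : Prop :=
  ω 0 = root A inputs ∧ ∀ k, ω (k + 1) ∈ (σ.next (ω k)).support

theorem Strategy.ae_eval_mem_support (n : ℕ) :
    ∀ᵐ ω ∂(σ.pathMeasure inputs), ω n ∈ (chainLaw σ.next n (root A inputs)).support := by
  have h := σ.pathMeasure_eval_mem inputs n (chainLaw σ.next n (root A inputs)).supportᶜ
  rw [(PMF.toOuterMeasure_apply_eq_zero_iff _ _).2 disjoint_compl_right] at h
  exact h

theorem Strategy.ae_step_of_eval_eq (n : ℕ) (v : Node A) :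
    ∀ᵐ ω ∂(σ.pathMeasure inputs), ω n = v → ω (n + 1) ∈ (σ.next v).support := by
  have hedge : (σ.pathMeasure inputs).map (fun ω => (ω n, ω (n + 1)))
      ({v} ×ˢ (σ.next v).supportᶜ) = 0 := by
    have hv : σ.kernel v (σ.next v).supportᶜ = 0 :=
      (PMF.toMeasure_apply_eq_zero_iff _ .of_discrete).2 disjoint_compl_right
    rw [σ.map_eval_pair_pathMeasure, Measure.compProd_apply_prod .of_discrete .of_discrete,
      lintegral_singleton, hv, zero_mul]
  rw [Measure.map_apply (by fun_prop) (.prod .of_discrete .of_discrete)] at hedge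
  filter_upwards [measure_eq_zero_iff_ae_notMem.1 hedge] with ω hω hωv
  by_contra hstep
  exact hω ⟨hωv, hstep⟩

theorem Strategy.ae_isPath : ∀ᵐ ω ∂(σ.pathMeasure inputs), σ.IsPath inputs ω := by
  have hstep : ∀ᵐ ω ∂(σ.pathMeasure inputs), ∀ n,
      ∀ v ∈ (chainLaw σ.next n (root A inputs)).support,
        ω n = v → ω (n + 1) ∈ (σ.next v).support :=
    ae_all_iff.2 fun n => (ae_ball_iff (PMF.support_countable _)).2 fun v _ =>
      σ.ae_step_of_eval_eq inputs n v
  filter_upwards [ae_all_iff.2 (σ.ae_eval_mem_support inputs), hstep] with ω hmem hstep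
  exact ⟨by simpa [chainLaw] using hmem 0, fun k => hstep k (ω k) (hmem k) rfl⟩

end PathMeasure

section Configurations

variable {c c' : Config A} {B : Set (Config A)} {σ : Strategy A} {x y : Node A}
  {inputs : Party t → V} {ω : ℕ → Node A}

/-- The history order: local histories and lists of sent messages are extended, and more messages
are delivered. Inputs are not compared, so an upper set is a property of what has happened in an
execution. -/
instance : Preorder (Config A) where
  le c c' := (∀ i, (c.loc i).events <+: (c'.loc i).events) ∧
    (∀ i j, c.sent i j <+: c'.sent i j) ∧ ∀ i j, c.delivered i j ⊆ c'.delivered i j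
  le_refl _ := ⟨fun _ => List.prefix_rfl, fun _ _ => List.prefix_rfl, fun _ _ => subset_rfl⟩
  le_trans _ _ _ h h' := ⟨fun i => (h.1 i).trans (h'.1 i),
    fun i j => (h.2.1 i j).trans (h'.2.1 i j), fun i j => (h.2.2 i j).trans (h'.2.2 i j)⟩

theorem Config.decided_mono (h : c ≤ c') {i : Party t} {a : V} (hi : (c.loc i).Decided a) :
    (c'.loc i).Decided a :=
  (h.1 i).subset hi

theorem Config.events_log_prefix (c : Config A) (i j : Party t) (e : A.Event) :
    (c.loc j).events <+: ((c.log i e).loc j).events := by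
  obtain rfl | hij := eq_or_ne j i
  · simp [Config.log]
  · simp [Config.log, hij]

theorem Config.le_deliver (c : Config A) (i j : Party t) (m : ℕ) : c ≤ c.deliver i j m := by
  unfold Config.deliver
  split
  · exact le_rfl
  · split
    · exact le_rfl
    · refine ⟨fun k => c.events_log_prefix j k _, fun _ _ => List.prefix_rfl, fun i' j' => ?_⟩
      dsimp only
      split_ifs with hlink
      · obtain ⟨rfl, rfl⟩ := hlink
        exact Finset.subset_insert _ _
      · exact subset_rfl

theorem Config.le_of_mem_support_perform {i : Party t} {a : A.Act}
    (h : c' ∈ (c.perform i a).support) : c ≤ c' := by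
  cases a with
  | skip | decide =>
    rw [perform, PMF.support_pure, Set.mem_singleton_iff] at h
    exact h ▸ ⟨fun k => c.events_log_prefix i k _, fun _ _ => List.prefix_rfl,
      fun _ _ => subset_rfl⟩
  | send j m =>
    rw [perform, PMF.support_pure, Set.mem_singleton_iff] at h
    refine h ▸ ⟨fun k => c.events_log_prefix i k _, fun i' j' => ?_, fun _ _ => subset_rfl⟩
    dsimp only
    split_ifs with hlink
    · obtain ⟨rfl, rfl⟩ := hlink
      exact List.prefix_append _ _
    · exact List.prefix_rfl
  | access o q =>
    rw [perform, PMF.support_map] at h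
    obtain ⟨r, -, rfl⟩ := h
    exact ⟨fun k => c.events_log_prefix i k _, fun _ _ => List.prefix_rfl,
      fun _ _ => subset_rfl⟩

theorem Config.mem_delivered_deliver {i j : Party t} {m : ℕ} (h : m ∈ c.pending i j) :
    m ∈ (c.deliver i j m).delivered i j := by
  obtain ⟨hsent, hnew⟩ := Finset.mem_sdiff.1 h
  simp [Config.deliver, List.getElem?_eq_getElem (Finset.mem_range.1 hsent), hnew]

theorem Strategy.mem_support_next :
    y ∈ (σ.next x).support ↔
      y.past = x.conf.observe σ.corrupted :: x.past ∧ y.conf ∈ (σ.nextConf x).support := by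
  rw [Strategy.next, PMF.support_map]
  constructor
  · rintro ⟨c, hc, rfl⟩
    exact ⟨rfl, hc⟩
  · rintro ⟨hpast, hconf⟩
    exact ⟨y.conf, hconf, by rw [← hpast]⟩

theorem Strategy.conf_le_of_mem_support_next (h : y ∈ (σ.next x).support) : x.conf ≤ y.conf := by
  have hconf := (Strategy.mem_support_next.1 h).2
  unfold Strategy.nextConf at hconf
  split at hconf
  · exact Config.le_of_mem_support_perform hconf
  · rw [PMF.support_pure, Set.mem_singleton_iff] at hconf
    exact hconf ▸ x.conf.le_deliver _ _ _

theorem Strategy.absorbing_of_isUpperSet (σ : Strategy A) (hB : IsUpperSet B) :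
    Absorbing σ.next (Node.conf ⁻¹' B) :=
  fun _ hx _ hy => hB (σ.conf_le_of_mem_support_next hy) hx

theorem Strategy.IsPath.monotone_conf (hω : σ.IsPath inputs ω) : Monotone fun k => (ω k).conf :=
  monotone_nat_of_le_succ fun k => σ.conf_le_of_mem_support_next (hω.2 k)

theorem Strategy.IsPath.length_past (hω : σ.IsPath inputs ω) (k : ℕ) : (ω k).past.length = k := by
  induction k with
  | zero => rw [hω.1]; rfl
  | succ k ih => rw [(Strategy.mem_support_next.1 (hω.2 k)).1, List.length_cons, ih]

/-- The configuration with the same history and the inputs replaced. -/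
def Config.setInputs (v : Party t → V) (c : Config A) : Config A :=
  { c with loc := fun i => ⟨v i, (c.loc i).events⟩ }

theorem Config.setInputs_mem_iff (hB : IsUpperSet B) (v : Party t → V) :
    c.setInputs v ∈ B ↔ c ∈ B := by
  have hle : c.setInputs v ≤ c := le_refl c
  have hge : c ≤ c.setInputs v := le_refl c
  exact ⟨fun h => hB hle h, fun h => hB hge h⟩

theorem Config.setInputs_log (v : Party t → V) (c : Config A) (i : Party t) (e : A.Event) :
    (c.setInputs v).log i e = (c.log i e).setInputs v := by
  simp only [Config.log, Config.setInputs, Config.mk.injEq, and_true]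
  funext j
  obtain rfl | hij := eq_or_ne j i
  · simp
  · simp [hij]

theorem Config.setInputs_deliver (v : Party t → V) (c : Config A) (i j : Party t) (m : ℕ) :
    (c.setInputs v).deliver i j m = (c.deliver i j m).setInputs v := by
  cases hm : (c.sent i j)[m]? with
  | none =>
    have hm' : ((c.setInputs v).sent i j)[m]? = none := hm
    simp only [Config.deliver, hm, hm']
  | some e =>
    have hm' : ((c.setInputs v).sent i j)[m]? = some e := hm
    simp only [Config.deliver, hm, hm']
    split_ifs with h₁ h₂ h₂
    · rfl
    · exact absurd h₁ h₂
    · exact absurd h₂ h₁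
    · rw [setInputs_log]
      rfl

theorem Config.setInputs_perform (v : Party t → V) (c : Config A) (i : Party t) (a : A.Act) :
    (c.setInputs v).perform i a = (c.perform i a).map (Config.setInputs v) := by
  cases a with
  | skip => simp only [perform, PMF.pure_map, setInputs_log]
  | decide x => simp only [perform, PMF.pure_map, setInputs_log]
  | send j m =>
    simp only [perform, PMF.pure_map, setInputs_log]
    rfl
  | access o q =>
    simp only [perform, PMF.map_comp, setInputs_log]
    rfl

theorem Strategy.absorbing_range_setInputs (σ : Strategy A) (v : Party t → V) :
    Absorbing σ.next (Node.conf ⁻¹' Set.range (Config.setInputs v)) := by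
  rintro x ⟨c, hc⟩ y hy
  have hconf := (Strategy.mem_support_next.1 hy).2
  unfold Strategy.nextConf at hconf
  split at hconf
  · rw [← hc, Config.setInputs_perform, PMF.support_map] at hconf
    exact Set.image_subset_range _ _ hconf
  · rw [← hc, Config.setInputs_deliver, PMF.support_pure, Set.mem_singleton_iff] at hconf
    exact ⟨_, hconf.symm⟩

end Configurations

section DelayStrategy

/-- The parties that have output a decision. -/
def Config.hasDecided (c : Config A) : Set (Party t) := {i | ∃ x, (c.loc i).Decided x}

/-- The configurations in which all parties outside `D` have decided. -/
def doneOutside (A : Algorithm.{u, w} t V) (D : Finset (Party t)) : Set (Config A) :=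
  {c | ∀ i, i ∉ D → i ∈ c.hasDecided}

theorem isUpperSet_doneOutside (D : Finset (Party t)) : IsUpperSet (doneOutside A D) :=
  fun _ _ hle hc i hi => (hc i hi).imp fun _ => Config.decided_mono hle

theorem elementaryStrategy_choice (C : Finset (Party t)) (hC : C.card ≤ t)
    (pretend : Party t → Option V) (len : ℕ) (table : Fin (len + 1) → Set (Party t) → Entry t)
    (x : Node A) :
    (elementaryStrategy A C hC pretend len table).choice x =
      match table (Fin.ofNat (len + 1) x.past.length) x.conf.hasDecided with
      | Entry.step i => Sched.step i
      | Entry.deliverOldest i j => Sched.deliver i j (sInf (x.conf.pending i j : Set ℕ)) :=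
  rfl

instance : Finite (Entry t) :=
  Finite.of_surjective
    (Sum.elim Entry.step fun link : Party t × Party t => Entry.deliverOldest link.1 link.2)
    fun
    | .step i => ⟨.inl i, rfl⟩
    | .deliverOldest i j => ⟨.inr (i, j), rfl⟩

instance : Nonempty (Entry t) := ⟨.step 0⟩

/-- An enumeration of all entries. The number of entries is written as a successor because
`elementaryStrategy` takes tables of length `len + 1`. -/
noncomputable def roundRobin (t : ℕ) : Fin (Nat.card (Entry t) - 1 + 1) ≃ Entry t :=
  (finCongr (Nat.sub_add_cancel Finite.card_pos)).trans (Finite.equivFin _).symm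

theorem frequently_roundRobin_eq (e : Entry t) :
    ∃ᶠ k in Filter.atTop, roundRobin t (Fin.ofNat _ k) = e :=
  (Nat.frequently_mod_eq ((roundRobin t).symm e).isLt).mono fun k hk => by
    rw [← (roundRobin t).apply_symm_apply e]
    exact congrArg _ (Fin.ext hk)

open Classical in
/-- The scheduling table that goes through all entries in turn, except that the parties of `D` take
no step before all others have decided. -/
noncomputable def delayTable (D : Finset (Party t)) (k : Fin (Nat.card (Entry t) - 1 + 1))
    (s : Set (Party t)) : Entry t :=
  match roundRobin t k with
  | Entry.step i => if i ∈ D ∧ ¬ ∀ j ∉ D, j ∈ s then Entry.deliverOldest i i else Entry.step i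
  | Entry.deliverOldest i j => Entry.deliverOldest i j

theorem mem_of_delayTable_eq_step {D : Finset (Party t)} {k : Fin (Nat.card (Entry t) - 1 + 1)}
    {s : Set (Party t)} {i : Party t} (h : delayTable D k s = Entry.step i) (hi : i ∈ D) :
    ∀ j ∉ D, j ∈ s := by
  unfold delayTable at h
  split at h
  · split_ifs at h with hwait
    obtain rfl := Entry.step.inj h
    exact not_not.1 fun hs => hwait ⟨hi, hs⟩
  · cases h

/-- The parties in `C` are corrupted and run the algorithm as if their inputs were given by `w`;
the parties in `D` are delayed until all others have decided. -/
noncomputable def delayStrategy (A : Algorithm.{u, w} t V) (C : Finset (Party t)) (hC : C.card ≤ t)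
    (w : Party t → V) (D : Finset (Party t)) : Strategy A :=
  elementaryStrategy A C hC (fun i => some (w i)) _ (delayTable D)

variable {C : Finset (Party t)} {hC : C.card ≤ t} {w : Party t → V} {D : Finset (Party t)}
  {inputs : Party t → V} {ω : ℕ → Node A}

theorem frequently_choice_eq_deliver (hω : (delayStrategy A C hC w D).IsPath inputs ω)
    (i j : Party t) :
    ∃ᶠ k in Filter.atTop, (delayStrategy A C hC w D).choice (ω k) =
      Sched.deliver i j (sInf ((ω k).conf.pending i j : Set ℕ)) :=
  (frequently_roundRobin_eq (Entry.deliverOldest i j)).mono fun k hk => by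
    rw [delayStrategy, elementaryStrategy_choice, hω.length_past, delayTable, hk]

theorem frequently_choice_eq_step (hω : (delayStrategy A C hC w D).IsPath inputs ω) {i : Party t}
    (hi : i ∉ D ∨ ∃ k, (ω k).conf ∈ doneOutside A D) :
    ∃ᶠ k in Filter.atTop, (delayStrategy A C hC w D).choice (ω k) = Sched.step i := by
  have hfree : ∀ᶠ k in Filter.atTop, i ∉ D ∨ (ω k).conf ∈ doneOutside A D := by
    obtain hi | ⟨n, hn⟩ := hi
    · exact .of_forall fun _ => .inl hi
    · exact (Filter.eventually_ge_atTop n).mono fun k hk =>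
        .inr (isUpperSet_doneOutside D (hω.monotone_conf hk) hn)
  refine ((frequently_roundRobin_eq (Entry.step i)).and_eventually hfree).mono ?_
  rintro k ⟨hk, hfree⟩
  have hgo : ¬ (i ∈ D ∧ ¬ ∀ j ∉ D, j ∈ (ω k).conf.hasDecided) :=
    fun hwait => hfree.elim (fun hi => hi hwait.1) hwait.2
  rw [delayStrategy, elementaryStrategy_choice, hω.length_past, delayTable, hk]
  dsimp only
  rw [if_neg hgo]

theorem eventually_mem_delivered (hω : (delayStrategy A C hC w D).IsPath inputs ω)
    {i j : Party t} {k m : ℕ} (hm : m < ((ω k).conf.sent i j).length) :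
    ∀ᶠ n in Filter.atTop, m ∈ (ω n).conf.delivered i j := by
  induction m using Nat.strong_induction_on with
  | _ m ih =>
  have hearlier : ∀ᶠ n in Filter.atTop, ∀ m' < m, m' ∈ (ω n).conf.delivered i j :=
    (Filter.eventually_all_finite (Set.finite_lt_nat m)).2 fun m' hm' => ih m' hm' (hm'.trans hm)
  obtain ⟨n, hchoice, hearlier, hkn⟩ := ((frequently_choice_eq_deliver hω i j).and_eventually
    (hearlier.and (Filter.eventually_ge_atTop k))).exists
  suffices m ∈ (ω (n + 1)).conf.delivered i j from
    (Filter.eventually_ge_atTop (n + 1)).mono fun n' hn' => (hω.monotone_conf hn').2.2 i j this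
  by_cases hdelivered : m ∈ (ω n).conf.delivered i j
  · exact (hω.monotone_conf n.le_succ).2.2 i j hdelivered
  have hpending : m ∈ (ω n).conf.pending i j := Finset.mem_sdiff.2
    ⟨Finset.mem_range.2 (hm.trans_le ((hω.monotone_conf hkn).2.1 i j).length_le), hdelivered⟩
  have holdest : sInf ((ω n).conf.pending i j : Set ℕ) = m := IsLeast.csInf_eq
    ⟨hpending, fun m' hm' => not_lt.1 fun hlt => (Finset.mem_sdiff.1 hm').2 (hearlier m' hlt)⟩
  have hnext := (Strategy.mem_support_next.1 (hω.2 n)).2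
  rw [Strategy.nextConf, hchoice, holdest, PMF.support_pure, Set.mem_singleton_iff] at hnext
  exact hnext ▸ Config.mem_delivered_deliver hpending

theorem delayStrategy_fair (hω : (delayStrategy A C hC w D).IsPath inputs ω)
    (hD : D ⊆ C ∨ ∃ k, (ω k).conf ∈ doneOutside A D) : (delayStrategy A C hC w D).Fair ω := by
  refine ⟨fun i hi => ?_, fun i j k m hm => ?_⟩
  · exact Filter.frequently_atTop.1
      (frequently_choice_eq_step hω (hD.imp_left fun hDC hiD => hi (hDC hiD)))
  · exact (eventually_mem_delivered hω (Finset.mem_range.1 (Finset.mem_sdiff.1 hm).1)).exists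

end DelayStrategy

section DelayedRun

/-- One step of the run in which no party is corrupted and the scheduling is read off the table; the
first component is the time. -/
noncomputable def faultFreeNext {len : ℕ} (table : Fin (len + 1) → Set (Party t) → Entry t)
    (s : ℕ × Config A) : PMF (ℕ × Config A) :=
  (match table (Fin.ofNat (len + 1) s.1) s.2.hasDecided with
    | Entry.step i => s.2.perform i (A.prog i (s.2.loc i).input (s.2.loc i).events)
    | Entry.deliverOldest i j =>
      PMF.pure (s.2.deliver i j (sInf (s.2.pending i j : Set ℕ)))).map (Prod.mk (s.1 + 1))

/-- For every set of configurations, the supremum over `n` of the probability that it contains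
the configuration after `n` steps of the fault-free run with inputs `w` and delayed parties `D`,
stopped as soon as all parties outside `D` have decided. On upper sets this is the probability that
the stopped run ever reaches the set. -/
noncomputable def delayedRun (A : Algorithm.{u, w} t V) (w : Party t → V) (D : Finset (Party t)) :
    OuterMeasure (Config A) :=
  ⨆ n, ((chainLaw (stopOn (Prod.snd ⁻¹' doneOutside A D) (faultFreeNext (delayTable D))) n
    (0, Config.init A w)).map Prod.snd).toOuterMeasure

/-- The time and the configuration at a node, with the inputs replaced by `w`: all that matters if
the corrupted parties pretend that the inputs are `w`. -/
def Node.view (w : Party t → V) (x : Node A) : ℕ × Config A :=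
  (x.past.length, x.conf.setInputs w)

variable {C : Finset (Party t)} {hC : C.card ≤ t} {v w : Party t → V} {D : Finset (Party t)}
  {B : Set (Config A)} {x : Node A}

theorem map_view_next (hvw : ∀ i, i ∉ C → i ∉ D → v i = w i)
    (hx : x.conf ∈ Set.range (Config.setInputs v)) (hdone : x.conf ∉ doneOutside A D) :
    ((delayStrategy A C hC w D).next x).map (Node.view w) =
      faultFreeNext (delayTable D) (x.view w) := by
  obtain ⟨c, hc⟩ := hx
  have hinput (i : Party t) : (x.conf.loc i).input = v i := by rw [← hc]; rfl
  have hnextConf : ((delayStrategy A C hC w D).nextConf x).map (Config.setInputs w) =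
      match delayTable D (Fin.ofNat _ x.past.length) x.conf.hasDecided with
      | Entry.step i => (x.conf.setInputs w).perform i (A.prog i (w i) (x.conf.loc i).events)
      | Entry.deliverOldest i j => PMF.pure
          ((x.conf.setInputs w).deliver i j (sInf (x.conf.pending i j : Set ℕ))) := by
    rw [Strategy.nextConf, delayStrategy, elementaryStrategy_choice]
    cases hentry : delayTable D (Fin.ofNat _ x.past.length) x.conf.hasDecided with
    | deliverOldest i j => simp only [PMF.pure_map, Config.setInputs_deliver]
    | step i =>
      dsimp only
      rw [Config.setInputs_perform]
      congr 2
      by_cases hiC : i ∈ C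
      · simp [elementaryStrategy, Config.observe, hiC]
      · have hiD : i ∉ D := fun hiD => hdone (mem_of_delayTable_eq_step hentry hiD)
        simp [elementaryStrategy, hiC, hinput, hvw i hiC hiD]
  calc ((delayStrategy A C hC w D).next x).map (Node.view w)
      = (((delayStrategy A C hC w D).nextConf x).map (Config.setInputs w)).map
          (Prod.mk (x.past.length + 1)) := by
        rw [Strategy.next, PMF.map_comp, PMF.map_comp]
        rfl
    _ = faultFreeNext (delayTable D) (x.view w) := by
        rw [hnextConf]
        rfl

theorem delayedRun_apply (hvw : ∀ i, i ∉ C → i ∉ D → v i = w i) (hB : IsUpperSet B) :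
    delayedRun A w D B =
      ⨆ n, (chainLaw (stopOn (Node.conf ⁻¹' doneOutside A D) (delayStrategy A C hC w D).next) n
        (root A v)).toOuterMeasure (Node.conf ⁻¹' B) := by
  have hB_view : Prod.snd ∘ Node.view w ⁻¹' B = Node.conf ⁻¹' B :=
    Set.ext fun x => Config.setInputs_mem_iff hB w
  have hview : ∀ x ∈ Node.conf ⁻¹' Set.range (Config.setInputs v),
      (stopOn (Node.conf ⁻¹' doneOutside A D) (delayStrategy A C hC w D).next x).map
        (Node.view w) =
      stopOn (Prod.snd ⁻¹' doneOutside A D) (faultFreeNext (delayTable D)) (x.view w) := by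
    intro x hx
    have hdone : x.view w ∈ Prod.snd ⁻¹' doneOutside A D ↔ x.conf ∈ doneOutside A D :=
      Config.setInputs_mem_iff (isUpperSet_doneOutside D) w
    by_cases h : x ∈ Node.conf ⁻¹' doneOutside A D
    · rw [stopOn_of_mem h, stopOn_of_mem (hdone.2 h), PMF.pure_map]
    · rw [stopOn_of_notMem h, stopOn_of_notMem (mt hdone.1 h), map_view_next hvw hx h]
  rw [delayedRun, OuterMeasure.iSup_apply]
  refine iSup_congr fun n => ?_
  have hlaw := (((delayStrategy A C hC w D).absorbing_range_setInputs v).stopOn _).map_chainLaw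
    hview n (a := root A v) ⟨Config.init A v, rfl⟩
  have hroot : (root A v).view w = (0, Config.init A w) := rfl
  rw [← hroot, ← hlaw, PMF.map_comp, PMF.toOuterMeasure_map_apply, hB_view]

theorem measurableSet_exists_conf_mem (B : Set (Config A)) :
    MeasurableSet {ω : ℕ → Node A | ∃ n, (ω n).conf ∈ B} := by
  rw [Set.ofPred_exists]
  exact .iUnion fun n => (MeasurableSet.of_discrete (s := Node.conf ⁻¹' B)).preimage
    (measurable_pi_apply n)

theorem Strategy.pathMeasure_exists_mem (σ : Strategy A) (v : Party t → V) (hB : IsUpperSet B) :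
    σ.pathMeasure v {ω | ∃ n, (ω n).conf ∈ B} =
      ⨆ n, (chainLaw σ.next n (root A v)).toOuterMeasure (Node.conf ⁻¹' B) := by
  have hunion : {ω : ℕ → Node A | ∃ n, (ω n).conf ∈ B} = ⋃ n, {ω | (ω n).conf ∈ B} :=
    Set.ofPred_exists _
  rw [hunion, measure_iUnion_eq_iSup_accumulate]
  refine iSup_congr fun n => ?_
  rw [← σ.pathMeasure_eval_mem]
  refine measure_congr ?_
  filter_upwards [σ.ae_isPath v] with ω hω
  refine propext ⟨fun h => ?_, fun h => Set.subset_accumulate h⟩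
  obtain ⟨k, hkn, hk⟩ := Set.mem_accumulate.1 h
  exact hB (hω.monotone_conf hkn) hk

theorem delayedRun_le_pathMeasure (hC : C.card ≤ t) (hvw : ∀ i, i ∉ C → i ∉ D → v i = w i)
    (hB : IsUpperSet B) :
    delayedRun A w D B ≤
      (delayStrategy A C hC w D).pathMeasure v {ω | ∃ n, (ω n).conf ∈ B} := by
  rw [delayedRun_apply (hC := hC) hvw hB, Strategy.pathMeasure_exists_mem _ _ hB]
  exact iSup_mono fun n => ((Strategy.absorbing_of_isUpperSet _ hB).chainLaw_stopOn_le _ _ _)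

theorem pathMeasure_doneOutside_le_delayedRun (hC : C.card ≤ t)
    (hvw : ∀ i, i ∉ C → i ∉ D → v i = w i) :
    (delayStrategy A C hC w D).pathMeasure v {ω | ∃ n, (ω n).conf ∈ doneOutside A D} ≤
      delayedRun A w D (doneOutside A D) := by
  rw [delayedRun_apply (hC := hC) hvw (isUpperSet_doneOutside D),
    Strategy.pathMeasure_exists_mem _ _ (isUpperSet_doneOutside D)]
  exact iSup_mono fun n => chainLaw_le_chainLaw_stopOn _ _ _ _

variable {Adv : AdversaryClass.{u, w} t V}

theorem Strategy.IsPath.exists_doneOutside {σ : Strategy A} {ω : ℕ → Node A}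
    (hω : σ.IsPath v ω) (h : ∀ i ∉ D, ∃ a, Ensemble.Decides ω i a) :
    ∃ k, (ω k).conf ∈ doneOutside A D := by
  have hdecided (i : Party t) : ∀ᶠ k in Filter.atTop, i ∉ D → i ∈ (ω k).conf.hasDecided := by
    by_cases hi : i ∈ D
    · exact .of_forall fun _ hi' => absurd hi hi'
    obtain ⟨a, n, hn⟩ := h i hi
    exact (Filter.eventually_ge_atTop n).mono fun k hk _ =>
      ⟨a, Config.decided_mono (hω.monotone_conf hk) hn⟩
  exact (Filter.eventually_all.2 hdecided).exists

theorem one_le_delayedRun_doneOutside (hAdv : CanRunAlgorithm Adv) (hterm : ProbTermination Adv A)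
    (hD : D.card ≤ t) (w : Party t → V) : 1 ≤ delayedRun A w D (doneOutside A D) := by
  let E : Ensemble A :=
    { inputs := w
      strategy := delayStrategy A D hD w D
      fair := ((delayStrategy A D hD w D).ae_isPath w).mono fun _ hω =>
        delayStrategy_fair hω (.inl subset_rfl) }
  have hdone : ∀ᵐ ω ∂E.prob, ∃ k, (ω k).conf ∈ doneOutside A D := by
    have hdecides : ∀ᵐ ω ∂E.prob, ∀ i ∉ D, ∃ a, Ensemble.Decides ω i a :=
      ae_all_iff.2 fun i => Filter.eventually_imp_distrib_left.2 fun hi =>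
        hterm E (hAdv _ _ _ _ _ _) i hi
    filter_upwards [E.strategy.ae_isPath w, hdecides] with ω hω h
    exact hω.exists_doneOutside h
  calc 1 = E.prob Set.univ := measure_univ.symm
    _ ≤ E.prob {ω | ∃ k, (ω k).conf ∈ doneOutside A D} :=
      measure_mono_ae (hdone.mono fun _ h _ => h)
    _ ≤ delayedRun A w D (doneOutside A D) :=
      pathMeasure_doneOutside_le_delayedRun hD fun _ _ _ => rfl

theorem exists_ensemble_delayedRun_le_prob (hAdv : CanRunAlgorithm Adv)
    (hterm : ProbTermination Adv A) (hC : C.card ≤ t) (hD : D.card ≤ t)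
    (hvw : ∀ i, i ∉ C → i ∉ D → v i = w i) :
    ∃ E : Ensemble A, E.strategy ∈ Adv A ∧ E.strategy.corrupted = C ∧ E.inputs = v ∧
      ∀ B, IsUpperSet B → delayedRun A w D B ≤ E.prob {ω | ∃ n, (ω n).conf ∈ B} := by
  let σ := delayStrategy A C hC w D
  have hdone : ∀ᵐ ω ∂(σ.pathMeasure v), ∃ k, (ω k).conf ∈ doneOutside A D := by
    refine (mem_ae_iff_prob_eq_one (measurableSet_exists_conf_mem _)).2 (prob_le_one.antisymm ?_)
    exact (one_le_delayedRun_doneOutside hAdv hterm hD w).trans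
      (delayedRun_le_pathMeasure hC hvw (isUpperSet_doneOutside D))
  have hfair : ∀ᵐ ω ∂(σ.pathMeasure v), σ.Fair ω := by
    filter_upwards [σ.ae_isPath v, hdone] with ω hω h
    exact delayStrategy_fair hω (.inr h)
  exact ⟨⟨v, σ, hfair⟩, hAdv _ _ _ _ _ _, rfl, rfl, fun B hB => delayedRun_le_pathMeasure hC hvw hB⟩

end DelayedRun

section Balancing

variable {ι α : Type*}

theorem exists_le_card_forall_fiber_card_le [Fintype ι] [DecidableEq α] (v : ι → α) {k m : ℕ}
    (hm : m ≤ Fintype.card ι) (hmk : m ≤ 2 * k)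
    (hv : ∀ a, (Finset.univ.filter (v · = a)).card + m ≤ Fintype.card ι + k) :
    ∃ R : Finset ι, m ≤ R.card ∧ ∀ a, (R.filter (v · = a)).card ≤ k := by
  classical
  by_cases hlarge : ∃ a, k ≤ (Finset.univ.filter (v · = a)).card
  swap
  · push Not at hlarge
    exact ⟨Finset.univ, hm, fun a => (hlarge a).le⟩
  obtain ⟨a, ha⟩ := hlarge
  obtain ⟨T, hTa, hTk⟩ := Finset.exists_subset_card_eq ha
  have hT (i : ι) (hi : i ∈ T) : v i = a := (Finset.mem_filter.1 (hTa hi)).2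
  by_cases hsecond : ∃ b ≠ a, k ≤ (Finset.univ.filter (v · = b)).card
  · obtain ⟨b, hba, hb⟩ := hsecond
    obtain ⟨U, hUb, hUk⟩ := Finset.exists_subset_card_eq hb
    have hU (i : ι) (hi : i ∈ U) : v i = b := (Finset.mem_filter.1 (hUb hi)).2
    have hTU : Disjoint T U :=
      Finset.disjoint_left.2 fun i hiT hiU => hba ((hU i hiU).symm.trans (hT i hiT))
    refine ⟨T ∪ U, by rw [Finset.card_union_of_disjoint hTU]; lia, fun c => ?_⟩
    have hfiber : (T ∪ U).filter (v · = c) ⊆ if c = a then T else U := by grind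
    refine (Finset.card_le_card hfiber).trans ?_
    split_ifs
    exacts [hTk.le, hUk.le]
  · push Not at hsecond
    have hdisj : Disjoint T (Finset.univ.filter (v · ≠ a)) :=
      Finset.disjoint_left.2 fun i hiT hi => (Finset.mem_filter.1 hi).2 (hT i hiT)
    have hcompl := Finset.card_filter_add_card_filter_not (s := Finset.univ) (v · = a)
    refine ⟨T ∪ Finset.univ.filter (v · ≠ a), ?_, fun c => ?_⟩
    · have := hv a
      rw [Finset.card_union_of_disjoint hdisj]
      rw [Finset.card_univ] at hcompl
      lia
    · by_cases hca : c = a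
      · refine (Finset.card_le_card (t := T) ?_).trans hTk.le
        grind
      · exact (Finset.card_le_card (Finset.filter_subset_filter _ (Finset.subset_univ _))).trans
          (hsecond c hca).le

theorem exists_card_eq_forall_fiber_card_le [Fintype ι] [DecidableEq α] (v : ι → α) {k m : ℕ}
    (hm : m ≤ Fintype.card ι) (hmk : m ≤ 2 * k)
    (hv : ∀ a, (Finset.univ.filter (v · = a)).card + m ≤ Fintype.card ι + k) :
    ∃ R : Finset ι, R.card = m ∧ ∀ a, (R.filter (v · = a)).card ≤ k := by
  obtain ⟨R, hmR, hRk⟩ := exists_le_card_forall_fiber_card_le v hm hmk hv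
  obtain ⟨R', hR', hcard⟩ := Finset.exists_subset_card_eq hmR
  exact ⟨R', hcard, fun a =>
    (Finset.card_le_card (Finset.filter_subset_filter _ hR')).trans (hRk a)⟩

theorem exists_map_univ_eq {n : ℕ} {M : Multiset α} (hM : M.card = n) :
    ∃ v : Fin n → α, Finset.univ.val.map v = M := by
  induction M using Quotient.inductionOn with | _ l
  obtain rfl : l.length = n := hM
  exact ⟨l.get, by rw [Fin.univ_val_map, List.ofFn_get]; rfl⟩

open Classical in
theorem count_le_maxMult (M : Multiset α) (a : α) : M.count a ≤ maxMult M := by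
  by_cases ha : a ∈ M
  · exact Finset.le_sup (f := fun x => M.count x) (Multiset.mem_toFinset.2 ha)
  · simp [Multiset.count_eq_zero_of_notMem ha]

open Classical in
theorem card_fiber_le_maxMult [Fintype ι] (v : ι → α) (a : α) :
    (Finset.univ.filter (v · = a)).card ≤ maxMult (Finset.univ.val.map v) := by
  refine le_trans (le_of_eq ?_) (count_le_maxMult _ a)
  simp only [Multiset.count_map, Finset.card_def, Finset.filter_val, eq_comm]

theorem exists_forall_ne_of_card_lt [Fintype ι] (h : (Fintype.card ι : ℕ∞) < ENat.card α)
    (v : ι → α) : ∃ a, ∀ i, v i ≠ a := by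
  by_contra! hsurj
  have hle : ENat.card α ≤ ENat.card ι :=
    ENat.card_le_card_of_injective (Function.injective_surjInv hsurj)
  exact h.not_ge (hle.trans_eq ENat.card_eq_coe_fintype_card)

end Balancing

section ValidityBounds

variable {Adv : AdversaryClass.{u, w} t V} {E : Ensemble A} {v w : Party t → V}
  {C D : Finset (Party t)} {a z : V}

theorem Ensemble.measurableSet_decidesInput (E : Ensemble A) :
    MeasurableSet {ω : ℕ → Node A | ∀ i, E.Honest i → ∃ x ∈ E.inputMultiset, Decides ω i x} := by
  have hsets : {ω : ℕ → Node A | ∀ i, E.Honest i → ∃ x ∈ E.inputMultiset, Decides ω i x} =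
      ⋂ i, ⋂ _ : E.Honest i,
        {ω | ∃ n, (ω n).conf ∈ {c | ∃ x ∈ E.inputMultiset, (c.loc i).Decided x}} := by
    ext ω
    simp only [Decides, Set.mem_iInter, Set.mem_ofPred_eq]
    exact forall₂_congr fun i _ => ⟨fun ⟨x, hx, n, hn⟩ => ⟨n, x, hx, hn⟩,
      fun ⟨n, x, hx, hn⟩ => ⟨x, hx, n, hn⟩⟩
  rw [hsets]
  exact .iInter fun i => .iInter fun _ => measurableSet_exists_conf_mem _

theorem Ensemble.probDecidesInput_le_one (E : Ensemble A) : E.probDecidesInput ≤ 1 :=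
  measureReal_le_one

theorem Ensemble.probDecidesInput_eq_one_iff :
    E.probDecidesInput = 1 ↔
      ∀ᵐ ω ∂E.prob, ∀ i, E.Honest i → ∃ x ∈ E.inputMultiset, Decides ω i x := by
  rw [probDecidesInput, measureReal_def, ENNReal.toReal_eq_one_iff]
  exact (mem_ae_iff_prob_eq_one E.measurableSet_decidesInput).symm

theorem Ensemble.AlwaysDecidesInput.probDecidesInput_eq_one (h : E.AlwaysDecidesInput)
    (hterm : ∀ i, E.Honest i → ∀ᵐ ω ∂E.prob, ∃ x, Decides ω i x) : E.probDecidesInput = 1 := by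
  have hdecides : ∀ᵐ ω ∂E.prob, ∀ i, E.Honest i → ∃ x, Decides ω i x :=
    ae_all_iff.2 fun i => ae_all_iff.2 (hterm i)
  refine probDecidesInput_eq_one_iff.2 ?_
  filter_upwards [E.strategy.ae_isPath E.inputs, hdecides] with ω hω hdec i hi
  obtain ⟨x, hx⟩ := hdec i hi
  exact ⟨x, h ω hω i hi x hx, hx⟩

theorem Ensemble.one_sub_le_probDecidesInput (hterm : ProbTermination Adv A)
    (hval : QualitativeValidity Adv A) (hE : E.strategy ∈ Adv A) :
    1 - (E.numCorrupted : ℝ) / (2 * t + 1) ≤ E.probDecidesInput := by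
  obtain ⟨hcertain, hlikely⟩ := hval E hE
  rcases le_or_gt (2 * t + 1 : ℤ) (maxMult E.inputMultiset - E.numCorrupted) with hmult | hmult
  · rw [(hcertain hmult).probDecidesInput_eq_one (hterm E hE)]
    exact sub_le_self _ (by positivity)
  · convert hlikely hmult using 3
    ring

theorem exists_notMem_of_card_le (hC : C.card ≤ t) (hD : D.card ≤ t) : ∃ i, i ∉ C ∧ i ∉ D := by
  have hlt : (C ∪ D).card < Fintype.card (Party t) := by
    have := Finset.card_union_le C D
    rw [Fintype.card_fin]
    lia
  obtain ⟨i, -, hi⟩ := Finset.exists_mem_notMem_of_card_lt_card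
    (hlt.trans_eq Finset.card_univ.symm)
  exact ⟨i, by grind, by grind⟩

/-- The configurations in which all parties outside `D` have decided on `a`. -/
def allDecided (A : Algorithm.{u, w} t V) (D : Finset (Party t)) (a : V) : Set (Config A) :=
  {c | ∀ i, i ∉ D → (c.loc i).Decided a}

theorem isUpperSet_allDecided (D : Finset (Party t)) (a : V) : IsUpperSet (allDecided A D a) :=
  fun _ _ h hc i hi => Config.decided_mono h (hc i hi)

theorem Ensemble.prob_allDecided_le (hagr : Agreement Adv A) (hE : E.strategy ∈ Adv A)
    (hD : D.card ≤ t) (ha : a ∉ E.inputMultiset) :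
    E.prob {ω | ∃ n, (ω n).conf ∈ allDecided A D a} ≤
      ENNReal.ofReal (1 - E.probDecidesInput) := by
  obtain ⟨i, hi, hiD⟩ := exists_notMem_of_card_le E.strategy.card_corrupted_le hD
  calc E.prob {ω | ∃ n, (ω n).conf ∈ allDecided A D a}
      ≤ E.prob {ω | ∀ i, E.Honest i → ∃ x ∈ E.inputMultiset, Decides ω i x}ᶜ := by
        refine measure_mono_ae ?_
        filter_upwards [E.strategy.ae_isPath E.inputs] with ω hω ⟨n, hn⟩ hinput
        obtain ⟨x, hx, hdec⟩ := hinput i hi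
        exact ha (hagr E hE ω hω i i hi hi x a hdec ⟨n, hn i hiD⟩ ▸ hx)
    _ = ENNReal.ofReal (1 - E.probDecidesInput) := by
        rw [prob_compl_eq_one_sub E.measurableSet_decidesInput, probDecidesInput,
          ENNReal.ofReal_sub _ measureReal_nonneg, ENNReal.ofReal_one, ofReal_measureReal]

/-- The configurations in which no value of `S` agrees with all decisions made so far. -/
def dissenting (A : Algorithm.{u, w} t V) (S : Finset V) : Set (Config A) :=
  {c | ∀ a ∈ S, ∃ i, ∃ x ≠ a, (c.loc i).Decided x}

theorem isUpperSet_dissenting (S : Finset V) : IsUpperSet (dissenting A S) := fun _ _ h hc a ha =>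
  let ⟨i, x, hxa, hx⟩ := hc a ha
  ⟨i, x, hxa, Config.decided_mono h hx⟩

theorem delayedRun_dissenting_eq_zero (hAdv : CanRunAlgorithm Adv) (hagr : Agreement Adv A)
    (hterm : ProbTermination Adv A) (hval : QualitativeValidity Adv A) (hD : D.card ≤ t)
    {S : Finset V} (hS : ∀ i, w i ∈ S) : delayedRun A w D (dissenting A S) = 0 := by
  obtain ⟨E, hE, hcorrupted, rfl, hprob⟩ := exists_ensemble_delayedRun_le_prob hAdv hterm
    (C := ∅) (by simp) hD fun i _ _ => Eq.refl (w i)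
  have hhonest (i : Party t) : E.Honest i := by simp [Ensemble.Honest, hcorrupted]
  have hinput : ∀ᵐ ω ∂E.prob, ∀ i, E.Honest i → ∃ x ∈ E.inputMultiset, Ensemble.Decides ω i x := by
    refine Ensemble.probDecidesInput_eq_one_iff.1 (E.probDecidesInput_le_one.antisymm ?_)
    simpa [Ensemble.numCorrupted, hcorrupted] using E.one_sub_le_probDecidesInput hterm hval hE
  refine nonpos_iff_eq_zero.1 ((hprob _ (isUpperSet_dissenting S)).trans_eq ?_)
  refine measure_mono_null_ae ?_ measure_empty
  filter_upwards [hinput, E.strategy.ae_isPath E.inputs] with ω hω hpath ⟨n, hn⟩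
  obtain ⟨a, ha, hdec⟩ := hω 0 (hhonest 0)
  obtain ⟨j, -, rfl⟩ := Multiset.mem_map.1 ha
  obtain ⟨i, x, hxa, hx⟩ := hn _ (hS j)
  exact hxa (hagr E hE ω hpath i 0 (hhonest i) (hhonest 0) x _ ⟨n, hx⟩ hdec)

theorem one_le_sum_delayedRun_allDecided (hAdv : CanRunAlgorithm Adv) (hagr : Agreement Adv A)
    (hterm : ProbTermination Adv A) (hval : QualitativeValidity Adv A) (hD : D.card ≤ t)
    {S : Finset V} (hS : ∀ i, w i ∈ S) : 1 ≤ ∑ a ∈ S, delayedRun A w D (allDecided A D a) := by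
  have hsubset : doneOutside A D ⊆ dissenting A S ∪ ⋃ a ∈ S, allDecided A D a := by
    intro c hc
    by_cases hdissent : c ∈ dissenting A S
    · exact .inl hdissent
    obtain ⟨a, ha, hall⟩ : ∃ a ∈ S, ∀ i x, (c.loc i).Decided x → x = a := by
      simp only [dissenting, Set.mem_ofPred_eq] at hdissent
      grind
    refine .inr (Set.mem_biUnion ha fun i hi => ?_)
    obtain ⟨x, hx⟩ := hc i hi
    exact hall i x hx ▸ hx
  calc 1 ≤ delayedRun A w D (doneOutside A D) := one_le_delayedRun_doneOutside hAdv hterm hD w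
    _ ≤ delayedRun A w D (dissenting A S ∪ ⋃ a ∈ S, allDecided A D a) := measure_mono hsubset
    _ ≤ delayedRun A w D (dissenting A S) + delayedRun A w D (⋃ a ∈ S, allDecided A D a) :=
      measure_union_le _ _
    _ ≤ ∑ a ∈ S, delayedRun A w D (allDecided A D a) := by
      rw [delayedRun_dissenting_eq_zero hAdv hagr hterm hval hD hS, zero_add]
      exact measure_biUnion_finset_le _ _

theorem delayedRun_allDecided_le (hAdv : CanRunAlgorithm Adv) (hagr : Agreement Adv A)
    (hterm : ProbTermination Adv A) (hval : QualitativeValidity Adv A) (hC : C.card ≤ t)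
    (hD : D.card ≤ t) (hwa : ∀ i, w i = a → i ∈ C) (hza : z ≠ a) :
    delayedRun A w D (allDecided A D a) ≤ ENNReal.ofReal (C.card / (2 * t + 1)) := by
  classical
  obtain ⟨E, hE, hcorrupted, hinputs, hprob⟩ :=
    exists_ensemble_delayedRun_le_prob (w := w) (v := fun i => if w i = a then z else w i)
      hAdv hterm hC hD fun i hi _ => if_neg (mt (hwa i) hi)
  have ha : a ∉ E.inputMultiset := by
    rw [Ensemble.inputMultiset, hinputs, Multiset.mem_map]
    grind
  have hbound := E.one_sub_le_probDecidesInput hterm hval hE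
  rw [Ensemble.numCorrupted, hcorrupted] at hbound
  calc delayedRun A w D (allDecided A D a)
      ≤ E.prob {ω | ∃ n, (ω n).conf ∈ allDecided A D a} := hprob _ (isUpperSet_allDecided D a)
    _ ≤ ENNReal.ofReal (1 - E.probDecidesInput) := E.prob_allDecided_le hagr hE hD ha
    _ ≤ ENNReal.ofReal (C.card / (2 * t + 1)) := ENNReal.ofReal_le_ofReal (by linarith)

theorem one_le_delayedRun_allDecided_add [DecidableEq V] (hAdv : CanRunAlgorithm Adv)
    (hagr : Agreement Adv A) (hterm : ProbTermination Adv A) (hval : QualitativeValidity Adv A)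
    (hD : D.card ≤ t) (hw : ∀ a ≠ z, (Finset.univ.filter (w · = a)).card ≤ t) :
    1 ≤ delayedRun A w D (allDecided A D z) +
      ENNReal.ofReal ((Finset.univ.filter (w · ≠ z)).card / (2 * t + 1)) := by
  let S : Finset V := (Finset.univ.filter (w · ≠ z)).image w
  have hzS : z ∉ S := by simp [S]
  have hbound (a : V) (ha : a ∈ S) : delayedRun A w D (allDecided A D a) ≤
      ENNReal.ofReal ((Finset.univ.filter (w · = a)).card / (2 * t + 1)) := by
    have haz : a ≠ z := ne_of_mem_of_not_mem ha hzS
    exact delayedRun_allDecided_le hAdv hagr hterm hval (hw a haz) hD (by simp) haz.symm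
  have hcard : (Finset.univ.filter (w · ≠ z)).card =
      ∑ a ∈ S, (Finset.univ.filter (w · = a)).card := by
    rw [Finset.card_eq_sum_card_image w]
    refine Finset.sum_congr rfl fun a ha => ?_
    rw [Finset.filter_filter]
    congr 1
    grind
  calc 1 ≤ ∑ a ∈ insert z S, delayedRun A w D (allDecided A D a) :=
        one_le_sum_delayedRun_allDecided hAdv hagr hterm hval hD fun i => by grind
    _ = delayedRun A w D (allDecided A D z) + ∑ a ∈ S, delayedRun A w D (allDecided A D a) :=
        Finset.sum_insert hzS
    _ ≤ delayedRun A w D (allDecided A D z) +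
          ∑ a ∈ S, ENNReal.ofReal ((Finset.univ.filter (w · = a)).card / (2 * t + 1)) := by
        gcongr with a ha
        exact hbound a ha
    _ = _ := by
        rw [hcard, Nat.cast_sum, Finset.sum_div,
          ENNReal.ofReal_sum_of_nonneg fun _ _ => by positivity]

end ValidityBounds

section Attainment

variable {Adv : AdversaryClass.{u, w} t V} {f : ℕ} {v : Party t → V}

theorem exists_ensemble_probDecidesInput_le_of_balanced [DecidableEq V] (hAdv : CanRunAlgorithm Adv)
    (hagr : Agreement Adv A) (hterm : ProbTermination Adv A) (hval : QualitativeValidity Adv A)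
    (hf : f ≤ t) {R : Finset (Party t)} (hR : R.card + f = 2 * t + 1)
    (hbalanced : ∀ a, (R.filter (v · = a)).card ≤ t) {z : V} (hz : ∀ i, v i ≠ z) :
    ∃ E : Ensemble A, E.strategy ∈ Adv A ∧ E.numCorrupted = f ∧ E.inputs = v ∧
      E.probDecidesInput ≤ 1 - (f : ℝ) / (2 * t + 1) := by
  have hcompl : Rᶜ.card = f + t := by
    rw [Finset.card_compl, Fintype.card_fin]
    lia
  obtain ⟨C, hCR, hCf⟩ := Finset.exists_subset_card_eq (show f ≤ Rᶜ.card by lia)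
  let D := Rᶜ \ C
  have hD : D.card ≤ t := by
    rw [Finset.card_sdiff_of_subset hCR]
    lia
  let w : Party t → V := fun i => if i ∈ R then v i else z
  have hvw (i : Party t) (hiC : i ∉ C) (hiD : i ∉ D) : v i = w i := by
    grind [Finset.mem_compl]
  obtain ⟨E, hE, hEC, hEv, hprob⟩ :=
    exists_ensemble_delayedRun_le_prob hAdv hterm (hCf.le.trans hf) hD hvw
  refine ⟨E, hE, by rw [Ensemble.numCorrupted, hEC, hCf], hEv, ?_⟩
  have hzE : z ∉ E.inputMultiset := by
    rw [Ensemble.inputMultiset, hEv, Multiset.mem_map]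
    exact fun ⟨i, _, hi⟩ => hz i hi
  have hw (a : V) (ha : a ≠ z) : (Finset.univ.filter (w · = a)).card ≤ t := by
    refine (Finset.card_le_card fun i hi => ?_).trans (hbalanced a)
    grind
  have hwR : Finset.univ.filter (w · ≠ z) = R := by grind
  have hone := calc
    1 ≤ delayedRun A w D (allDecided A D z) + ENNReal.ofReal (R.card / (2 * t + 1)) :=
      hwR ▸ one_le_delayedRun_allDecided_add hAdv hagr hterm hval hD hw
    _ ≤ ENNReal.ofReal (1 - E.probDecidesInput) + ENNReal.ofReal (R.card / (2 * t + 1)) := by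
      gcongr
      exact (hprob _ (isUpperSet_allDecided D z)).trans (E.prob_allDecided_le hagr hE hD hzE)
    _ = ENNReal.ofReal (1 - E.probDecidesInput + R.card / (2 * t + 1)) :=
      (ENNReal.ofReal_add (sub_nonneg.2 E.probDecidesInput_le_one) (by positivity)).symm
  rw [ENNReal.one_le_ofReal] at hone
  have hfrac : (R.card : ℝ) / (2 * t + 1) + f / (2 * t + 1) = 1 := by
    rw [← add_div, div_eq_one_iff_eq (by positivity)]
    exact_mod_cast hR
  linarith

theorem exists_ensemble_probDecidesInput_le_of_maxMult_le
    (hV : ((3 * t + 1 : ℕ) : ℕ∞) < ENat.card V) (hAdv : CanRunAlgorithm Adv)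
    (hagr : Agreement Adv A) (hterm : ProbTermination Adv A) (hval : QualitativeValidity Adv A)
    (hf : f ≤ t) (hv : maxMult (Finset.univ.val.map v) ≤ 2 * t + f) :
    ∃ E : Ensemble A, E.strategy ∈ Adv A ∧ E.numCorrupted = f ∧ E.inputs = v ∧
      E.probDecidesInput ≤ 1 - (f : ℝ) / (2 * t + 1) := by
  classical
  obtain rfl | hfpos := f.eq_zero_or_pos
  · obtain ⟨E, hE, hEC, hEv, -⟩ := exists_ensemble_delayedRun_le_prob (A := A) hAdv hterm
      (C := ∅) (D := ∅) (by simp) (by simp) fun i _ _ => Eq.refl (v i)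
    refine ⟨E, hE, by simp [Ensemble.numCorrupted, hEC], hEv, ?_⟩
    simpa using E.probDecidesInput_le_one
  · have hfiber (a : V) : (Finset.univ.filter (v · = a)).card + (2 * t + 1 - f) ≤
        Fintype.card (Party t) + t := by
      have := card_fiber_le_maxMult v a
      rw [Fintype.card_fin]
      lia
    obtain ⟨R, hR, hbalanced⟩ := exists_card_eq_forall_fiber_card_le v
      (by rw [Fintype.card_fin]; lia) (by lia) hfiber
    obtain ⟨z, hz⟩ := exists_forall_ne_of_card_lt (by rwa [Fintype.card_fin]) v
    exact exists_ensemble_probDecidesInput_le_of_balanced hAdv hagr hterm hval hf (by lia)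
      hbalanced hz

theorem not_strictSomewhere (hV : ((3 * t + 1 : ℕ) : ℕ∞) < ENat.card V)
    (hAdv : CanRunAlgorithm Adv) (hagr : Agreement Adv A) (hterm : ProbTermination Adv A)
    (hval : QualitativeValidity Adv A) : ¬ StrictSomewhere Adv A := by
  rintro ⟨f, hf, M, hM, hmult, hstrict⟩
  obtain ⟨v, rfl⟩ := exists_map_univ_eq hM
  obtain ⟨E, hE, hEf, hEv, hle⟩ := exists_ensemble_probDecidesInput_le_of_maxMult_le hV hAdv hagr
    hterm hval hf (v := v) (by lia)
  have hlt := hstrict E hE hEf (by rw [Ensemble.inputMultiset, hEv])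
  rw [show (3 * t + 1 : ℝ) - t = 2 * t + 1 by ring] at hlt
  exact hlt.not_ge hle

end Attainment

end ByzAgr

theorem mainTheorem1 (t : ℕ) (V : Type*)
    (hV : ((3 * t + 1 : ℕ) : ℕ∞) < ENat.card V)
    (Adv : ByzAgr.AdversaryClass t V) (hAdv : ByzAgr.CanRunAlgorithm Adv)
    (Φ : ByzAgr.Algorithm t V → Prop) (hΦ : ByzAgr.StrictlyStronger Adv Φ) :
    ¬ ∃ A : ByzAgr.Algorithm t V,
      ByzAgr.Agreement Adv A ∧ ByzAgr.ProbTermination Adv A ∧ Φ A := by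
  rintro ⟨A, hagr, hterm, hA⟩
  obtain ⟨hval, hstrict⟩ := hΦ A hA
  exact ByzAgr.not_strictSomewhere hV hAdv hagr hterm hval hstrict
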